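/- Let $\mathcal A\subset\mathbb R^n$ be finite and nonempty and let $X\subset\mathbb R^n$ be closed, convex and nonempty, such that the functions $x\mapsto e^{\alpha^Tx}$, $\alpha\in\mathcal A$, are linearly independent on $X$. For $c\in\mathbb R^{\mathcal A}$ let $f_c(x)=\sum_{\alpha\in\mathcal A}c_\alpha e^{\alpha^Tx}$ ($x\in\mathbb R^n$), for $\nu\in\mathbb R^{\mathcal A}$ let $\mathcal A\nu=\sum_{\alpha\in\mathcal A}\nu_\alpha\alpha$, and let $\sigma_X(y)=\sup_{x\in X}y^Tx\in(-\infty,\infty]$. Fix $\beta\in\mathcal A$. - The $X$-AGE cone is $C_X(\mathcal A,\beta)=\{f_c : f_c\ge 0\text{ on }X,\ c_\alpha\ge 0\text{ for all }\alpha\ne\beta\}$. - Let $N_\beta=\{\nu\in\mathbb R^{\mathcal A} : \nu_\alpha\ge 0\text{ for all }\alpha\neq\beta,\ \sum_{\alpha\in\mathcal A}\nu_\alpha=0\}$. A vector $\nu\in N_\beta$ is an $X$-circuit if $\nu\ne 0$, $\sigma_X(-\mathcal A\nu)<\infty$, and $\nu$ cannot be written as $s\nu^{(1)}+t\nu^{(2)}$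 with $s,t>0$, $s+t=1$, where $\nu^{(1)},\nu^{(2)}\in N_\beta$ are linearly independent and $\nu'\mapsto\sigma_X(-\mathcal A\nu')$ is finite and linear on the segment $[\nu^{(1)},\nu^{(2)}]$, i.e. $\sigma_X(-\mathcal A(p\nu^{(1)}+q\nu^{(2)}))=p\,\sigma_X(-\mathcal A\nu^{(1)})+q\,\sigma_X(-\mathcal A\nu^{(2)})$ for all $p,q\ge 0$ with $p+q=1$. Let $\Lambda_X(\mathcal A,\beta)$ be the set of normalized $X$-circuits with negative index $\beta$, i.e. of the $X$-circuits $\lambda\in N_\beta$ with $\lambda_\beta=-1$. - For $\lambda\in\Lambda_X(\mathcal A,\beta)$, the $\lambda$-witnessed AGE cone is $$C_X(\mathcal A,\lambda)=\Bigl\{f_c : \prod_{\alpha:\lambda_\alpha>0}\Bigl[\frac{c_\alpha}{\lambda_\alpha}\Bigr]^{\lambda_\alpha}\ge -c_\beta\exp\bigl(\sigma_X(-\mathcal A\lambda)\bigr),\ c_\alpha\ge 0\text{ for all }\alpha\neq\beta\Bigr\}.$$ Then, if $\Lambda_X(\mathcal A,\beta)\neq\emptyset$, $$C_X(\mathcal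 A,\beta)=\operatorname{conv}\bigcup_{\lambda\in\Lambda_X(\mathcal A,\beta)}C_X(\mathcal A,\lambda).$$ In the degenerate case $\Lambda_X(\mathcal A,\beta)=\emptyset$, the cone $C_X(\mathcal A,\beta)$ consists exactly of the posynomials $f_c$ with $c_\alpha\ge 0$ for all $\alpha\in\mathcal A$. -/

import Mathlib

open scoped BigOperators

noncomputable section

namespace CondSAGE

variable {n : ℕ}

/-- The signomial `∑ α ∈ A, c α * exp (αᵀ x)`, as a function on `ℝⁿ`. -/
def signomial (A : Finset (EuclideanSpace ℝ (Fin n))) (c : A → ℝ) :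
    EuclideanSpace ℝ (Fin n) → ℝ :=
  fun x => ∑ α : A, c α * Real.exp (inner ℝ (α : EuclideanSpace ℝ (Fin n)) x)

/-- The support function `σ_X(y) = sup {yᵀ x : x ∈ X}`, with values in the extended reals. -/
def supportFun (X : Set (EuclideanSpace ℝ (Fin n))) (y : EuclideanSpace ℝ (Fin n)) : EReal :=
  ⨆ x ∈ X, ((inner ℝ y x : ℝ) : EReal)

/-- The exponent set as a linear operator: `ν ↦ ∑ α ∈ A, ν α • α`. -/
def opA (A : Finset (EuclideanSpace ℝ (Fin n))) (ν : A → ℝ) : EuclideanSpace ℝ (Fin n) :=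
  ∑ α : A, ν α • (α : EuclideanSpace ℝ (Fin n))

/-- The augmented support function `ν ↦ σ_X(-A ν)`. -/
def augSupport (X : Set (EuclideanSpace ℝ (Fin n))) (A : Finset (EuclideanSpace ℝ (Fin n)))
    (ν : A → ℝ) : EReal :=
  supportFun X (-(opA A ν))

/-- The cone of `X`-AGE signomials with respect to `β`: signomials on `A`, nonnegative on `X`,
all of whose coefficients other than that of `β` are nonnegative. -/
def ageCone (X : Set (EuclideanSpace ℝ (Fin n))) (A : Finset (EuclideanSpace ℝ (Fin n)))
    (β : A) : Set (EuclideanSpace ℝ (Fin n) → ℝ) :=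
  {f | ∃ c : A → ℝ, f = signomial A c ∧ (∀ x ∈ X, 0 ≤ f x) ∧ ∀ α, α ≠ β → 0 ≤ c α}

/-- The posynomials on `A`: signomials with nonnegative coefficients. -/
def posynomials (A : Finset (EuclideanSpace ℝ (Fin n))) :
    Set (EuclideanSpace ℝ (Fin n) → ℝ) :=
  {f | ∃ c : A → ℝ, f = signomial A c ∧ ∀ α, 0 ≤ c α}

/-- The cone `N_β` of vectors with coordinate sum zero, nonnegative away from `β`. -/
def coneN (A : Finset (EuclideanSpace ℝ (Fin n))) (β : A) : Set (A → ℝ) :=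
  {ν | (∀ α, α ≠ β → 0 ≤ ν α) ∧ ∑ α, ν α = 0}

/-- The augmented support function is finite and linear on the segment `[ν₁, ν₂]`. -/
def LinearOnSegment (X : Set (EuclideanSpace ℝ (Fin n)))
    (A : Finset (EuclideanSpace ℝ (Fin n))) (ν₁ ν₂ : A → ℝ) : Prop :=
  augSupport X A ν₁ < ⊤ ∧ augSupport X A ν₂ < ⊤ ∧
    ∀ s t : ℝ, 0 ≤ s → 0 ≤ t → s + t = 1 →
      augSupport X A (s • ν₁ + t • ν₂) =
        (s : EReal) * augSupport X A ν₁ + (t : EReal) * augSupport X A ν₂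

/-- `ν` is an `X`-circuit of `A` in `N_β`: it is nonzero, the augmented support function is finite
at `ν`, and `ν` is not a proper convex combination of two non-proportional elements of `N_β` such
that the augmented support function is linear on the segment between them. -/
def IsXCircuit (X : Set (EuclideanSpace ℝ (Fin n))) (A : Finset (EuclideanSpace ℝ (Fin n)))
    (β : A) (ν : A → ℝ) : Prop :=
  ν ∈ coneN A β ∧ ν ≠ 0 ∧ augSupport X A ν < ⊤ ∧
    ¬ ∃ ν₁ ∈ coneN A β, ∃ ν₂ ∈ coneN A β, ∃ s t : ℝ,
      0 < s ∧ 0 < t ∧ s + t = 1 ∧ ν = s • ν₁ + t • ν₂ ∧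
        LinearIndependent ℝ ![ν₁, ν₂] ∧ LinearOnSegment X A ν₁ ν₂

/-- The normalized `X`-circuits of `A` with negative index `β`. -/
def normalizedXCircuits (X : Set (EuclideanSpace ℝ (Fin n)))
    (A : Finset (EuclideanSpace ℝ (Fin n))) (β : A) : Set (A → ℝ) :=
  {lam | IsXCircuit X A β lam ∧ lam β = -1}

/-- The `lam`-witnessed AGE cone, for `lam ∈ N_β` with `lam β = -1`. The inequality
`-c_β exp(σ_X(-A lam)) ≤ ∏_{α ∈ lam⁺} (c_α / lam_α) ^ lam_α` is read in the extended reals, where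
both sides are real numbers whenever `σ_X(-A lam)` is finite. -/
def witnessedAGECone (X : Set (EuclideanSpace ℝ (Fin n)))
    (A : Finset (EuclideanSpace ℝ (Fin n))) (β : A) (lam : A → ℝ) :
    Set (EuclideanSpace ℝ (Fin n) → ℝ) :=
  {f | ∃ c : A → ℝ, f = signomial A c ∧
    ((-c β : ℝ) : EReal) * (EReal.exp (augSupport X A lam) : EReal) ≤
      ((∏ α : A with 0 < lam α, (c α / lam α) ^ lam α : ℝ) : EReal) ∧
    ∀ α, α ≠ β → 0 ≤ c α}

end CondSAGE

end

/-!
A signomial `f_c` that is nonnegative on `X`, with `c α ≥ 0` for `α ≠ β`, is a posynomial unless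
`c β < 0`; so the content is to split such an `f_c` with `c β < 0` into signomials witnessed by
normalized circuits.

*Duality.* By Gibbs' variational principle the logarithm of `∑ α ≠ β, c α * exp ((α - β)ᵀ x)` is the
maximum of `(A ν)ᵀ x + ∑ α ≠ β, ν α * log (c α / ν α)` over the normalized `ν ∈ N_β`. This function
is concave and continuous in `ν`, which ranges over a compact set, and affine in `x`. Sion's minimax
theorem therefore gives a single `ν` for which it is at least `log (-c β)` at all points of `X`, that
is, `∑ α ≠ β, ν α * log (c α / ν α) - σ_X(-A ν) ≥ log (-c β)` (`exists_forall_dualFun_ge`).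

*Circuits.* For fixed `x₀ ∈ X`, the function `ν ↦ σ_X(-A ν) + (A ν)ᵀ x₀ - ν β` is sublinear on
`N_β`, lower semicontinuous, and positive away from the origin. Its unit sublevel set is compact and
convex, and its nonzero extreme points are multiples of circuits (`smul_mem_normalizedXCircuits`).
Minkowski's theorem (`IsCompact.subset_convexHull_extremePoints`) then writes `ν` as a convex
combination of normalized circuits `lam i` with weights `θ i` such that
`∑ θ i * σ_X(-A (lam i)) ≤ σ_X(-A ν)` (`exists_circuit_decomposition`).

*Splitting.* Give the circuit `lam i` the coefficients `c α * lam i α / ν α`. Jensen's inequality for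
the exponential shows that the negative coefficients at `β` which these witness average to at most
`c β` (`signomial_mem_convexHull_witnessedAGECone`). The converse inclusion is the weighted AM–GM
inequality (`witnessedAGECone_subset_ageCone`). Without circuits the splitting is impossible, so
`c β < 0` cannot occur.
-/

/-! ### Extreme points of compact convex sets in finite dimension -/

/-- By Carathéodory's theorem the convex hull is a finite union of continuous images of the compact
sets `stdSimplex ℝ (Fin k) × sᵏ`. -/
theorem IsCompact.convexHull_of_finiteDimensional {E : Type*} [NormedAddCommGroup E]
    [NormedSpace ℝ E] [FiniteDimensional ℝ E] {s : Set E} (hs : IsCompact s) :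
    IsCompact (convexHull ℝ s) := by
  have key : convexHull ℝ s = ⋃ k ∈ (Finset.range (Module.finrank ℝ E + 2) : Set ℕ),
      (fun p : (Fin k → ℝ) × (Fin k → E) => ∑ i, p.1 i • p.2 i) ''
        (stdSimplex ℝ (Fin k) ×ˢ Set.pi Set.univ (fun _ => s)) := by
    apply Set.Subset.antisymm
    · intro x hx
      obtain ⟨ι, _, z, w, hz, hind, hw, hw1, hx⟩ := eq_pos_convex_span_of_mem_convexHull hx
      have hcard : Fintype.card ι ≤ Module.finrank ℝ E + 1 := hind.card_le_finrank_succ.trans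
        (by gcongr; exact Submodule.finrank_le _)
      refine Set.mem_biUnion (x := Fintype.card ι) (by simp; omega) ?_
      let e := (Fintype.equivFin ι).symm
      refine ⟨(w ∘ e, z ∘ e), ⟨⟨fun i => (hw _).le, ?_⟩, fun i _ => hz ⟨e i, rfl⟩⟩, ?_⟩
      · exact (Equiv.sum_comp e w).trans hw1
      · exact (Equiv.sum_comp e (fun i => w i • z i)).trans hx
    · refine Set.iUnion₂_subset fun k _ => ?_
      rintro _ ⟨⟨w, z⟩, ⟨⟨hw, hw1⟩, hz⟩, rfl⟩
      exact (convex_convexHull ℝ s).sum_mem (fun i _ => hw i) hw1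
        fun i _ => subset_convexHull ℝ s (hz i trivial)
  rw [key]
  refine (Finset.finite_toSet _).isCompact_biUnion fun k _ => ?_
  refine ((isCompact_stdSimplex ℝ (Fin k)).prod (isCompact_univ_pi fun _ => hs)).image ?_
  fun_prop

/-- **Minkowski's theorem**: in finite dimension no closure is needed in the Krein–Milman theorem.
Among all finite convex combinations of points of `s` that represent a given point, one that
maximizes the average of a strictly convex function uses extreme points only. -/
theorem IsCompact.subset_convexHull_extremePoints {E : Type*} [NormedAddCommGroup E]
    [NormedSpace ℝ E] [FiniteDimensional ℝ E] {s : Set E} (hs : IsCompact s) :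
    s ⊆ convexHull ℝ (s.extremePoints ℝ) := by
  intro x hx
  set q : E → ℝ := fun z => ‖toEuclidean z‖ ^ 2 with hq
  have hqc : Continuous q := by fun_prop
  have hqs : ∀ a b : E, a ≠ b → ∀ s t : ℝ, 0 < s → 0 < t → s + t = 1 →
      q (s • a + t • b) < s * q a + t * q b := by
    intro a b hab s t hs ht hst
    have hne : 0 < ‖toEuclidean a - toEuclidean b‖ ^ 2 := by
      have : toEuclidean a - toEuclidean b ≠ 0 :=
        sub_ne_zero.2 fun h => hab (toEuclidean.injective h)
      positivity
    have h1 := norm_add_sq_real (s • toEuclidean a) (t • toEuclidean b)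
    rw [norm_sub_sq_real] at hne
    simp only [norm_smul, real_inner_smul_left, real_inner_smul_right, Real.norm_eq_abs,
      abs_of_pos hs, abs_of_pos ht] at h1
    simp only [hq, map_add, map_smul]
    rw [h1]
    have h2 := mul_pos (mul_pos hs ht) hne
    obtain rfl : t = 1 - s := by linarith
    nlinarith
  set P : Set (E × ℝ) := convexHull ℝ ((fun z => (z, q z)) '' s) with hP
  have hPc : IsCompact P :=
    (hs.image (by fun_prop : Continuous fun z => (z, q z))).convexHull_of_finiteDimensional
  have hPx : IsCompact (P ∩ {p | p.1 = x}) :=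
    hPc.inter_right (isClosed_eq continuous_fst continuous_const)
  obtain ⟨⟨x', r⟩, ⟨hrP, rfl⟩, hmax⟩ := hPx.exists_isMaxOn
    ⟨(x, q x), subset_convexHull ℝ _ ⟨x, hx, rfl⟩, rfl⟩ continuous_snd.continuousOn
  rw [isMaxOn_iff] at hmax
  obtain ⟨ι, _, z, w, hz, -, hw, hw1, hsum⟩ := eq_pos_convex_span_of_mem_convexHull hrP
  have hz' : ∀ i, ∃ y ∈ s, (y, q y) = z i := fun i => hz ⟨i, rfl⟩
  choose y hys hyz using hz'
  have hy1 : ∑ i, w i • y i = x' := by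
    have := congrArg Prod.fst hsum
    simpa [Prod.fst_sum, ← hyz] using this
  have hext : ∀ i, y i ∈ s.extremePoints ℝ := by
    classical
    intro i
    by_contra hne
    rw [mem_extremePoints] at hne
    push Not at hne
    obtain ⟨a, ha, b, hb, ⟨σ, τ, hσ, hτ, hστ, hab⟩, hne⟩ := hne (hys i)
    have hab' : a ≠ b := by
      rintro rfl
      have : a = y i := by rw [← hab, ← add_smul, hστ, one_smul]
      exact hne this this
    have hlt := hqs a b hab' σ τ hσ hτ hστ
    rw [hab] at hlt
    -- replacing the `i`-th point by its two-point representation increases the average of `q`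
    let z' : ι → E × ℝ := Function.update z i (σ • (a, q a) + τ • (b, q b))
    have hz'P : ∀ j, z' j ∈ P := by
      intro j
      by_cases hj : j = i
      · subst hj
        simp only [z', Function.update_self]
        exact convex_convexHull ℝ _ (subset_convexHull ℝ _ (Set.mem_image_of_mem _ ha))
          (subset_convexHull ℝ _ (Set.mem_image_of_mem _ hb)) hσ.le hτ.le hστ
      · simp only [z', Function.update_of_ne hj]
        exact subset_convexHull ℝ _ (hz ⟨j, rfl⟩)
    have hmem : ∑ j, w j • z' j ∈ P :=
      (convex_convexHull ℝ _).sum_mem (fun j _ => (hw j).le) hw1 fun j _ => hz'P j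
    have hfst : ∀ j, (z' j).1 = y j := by
      intro j
      by_cases hj : j = i
      · subst hj; simpa [z'] using hab
      · simp [z', Function.update_of_ne hj, ← hyz]
    have hsnd : ∑ j, w j * (z j).2 < ∑ j, w j * (z' j).2 := by
      refine Finset.sum_lt_sum (fun j _ => ?_) ⟨i, Finset.mem_univ _, ?_⟩
      · by_cases hj : j = i
        · subst hj
          refine mul_le_mul_of_nonneg_left ?_ (hw j).le
          simpa [z', ← hyz] using hlt.le
        · simp [z', Function.update_of_ne hj]
      · refine mul_lt_mul_of_pos_left ?_ (hw i)
        simpa [z', ← hyz] using hlt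
    have h1 := hmax (∑ j, w j • z' j) ⟨hmem, by simp [Prod.fst_sum, hfst, hy1]⟩
    have h2 := congrArg Prod.snd hsum
    simp only [Prod.snd_sum, Prod.smul_snd, smul_eq_mul] at h2
    simp only [Prod.snd_sum, Prod.smul_snd, smul_eq_mul] at h1
    linarith
  rw [← hy1]
  exact (convex_convexHull ℝ _).sum_mem (fun i _ => (hw i).le) hw1
    fun i _ => subset_convexHull ℝ _ (hext i)

noncomputable section

namespace CondSAGE

variable {n : ℕ}

/-! ### The augmented support function -/

theorem augSupport_le_coe_iff {X : Set (EuclideanSpace ℝ (Fin n))}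
    {A : Finset (EuclideanSpace ℝ (Fin n))} {ν : A → ℝ} {s : ℝ} :
    augSupport X A ν ≤ s ↔ ∀ x ∈ X, -inner ℝ (opA A ν) x ≤ s := by
  simp only [augSupport, supportFun, iSup₂_le_iff, EReal.coe_le_coe_iff, inner_neg_left]

theorem exists_augSupport_eq_coe {X : Set (EuclideanSpace ℝ (Fin n))} (hX : X.Nonempty)
    {A : Finset (EuclideanSpace ℝ (Fin n))} {ν : A → ℝ} (h : augSupport X A ν < ⊤) :
    ∃ s : ℝ, augSupport X A ν = s := by
  obtain ⟨x, hx⟩ := hX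
  have hbot : augSupport X A ν ≠ ⊥ := by
    intro hb
    have h1 : ((inner ℝ (-(opA A ν)) x : ℝ) : EReal) ≤ augSupport X A ν :=
      le_iSup₂ (f := fun x (_ : x ∈ X) => ((inner ℝ (-(opA A ν)) x : ℝ) : EReal)) x hx
    rw [hb, le_bot_iff] at h1
    exact EReal.coe_ne_bot _ h1
  exact ⟨_, (EReal.coe_toReal h.ne hbot).symm⟩

theorem inner_opA (A : Finset (EuclideanSpace ℝ (Fin n))) (ν : A → ℝ)
    (x : EuclideanSpace ℝ (Fin n)) :
    inner ℝ (opA A ν) x = ∑ α : A, ν α * inner ℝ (α : EuclideanSpace ℝ (Fin n)) x := by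
  simp [opA, sum_inner, real_inner_smul_left]

theorem opA_add (A : Finset (EuclideanSpace ℝ (Fin n))) (μ ν : A → ℝ) :
    opA A (μ + ν) = opA A μ + opA A ν := by
  simp [opA, add_smul, Finset.sum_add_distrib]

theorem opA_smul (A : Finset (EuclideanSpace ℝ (Fin n))) (s : ℝ) (ν : A → ℝ) :
    opA A (s • ν) = s • opA A ν := by
  simp [opA, Finset.smul_sum, mul_smul]

theorem opA_sum (A : Finset (EuclideanSpace ℝ (Fin n))) {ι : Type*} (s : Finset ι)
    (ν : ι → A → ℝ) : opA A (∑ i ∈ s, ν i) = ∑ i ∈ s, opA A (ν i) := by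
  simp only [opA, Finset.sum_apply, Finset.sum_smul]
  exact Finset.sum_comm

theorem continuous_opA (A : Finset (EuclideanSpace ℝ (Fin n))) : Continuous (opA A) := by
  unfold opA
  fun_prop

/-! ### The cone `N_β` -/

theorem convex_coneN (A : Finset (EuclideanSpace ℝ (Fin n))) (β : A) :
    Convex ℝ (coneN A β) := by
  rintro μ ⟨hμ, hμ0⟩ ν ⟨hν, hν0⟩ s t hs ht -
  refine ⟨fun α hα => ?_, ?_⟩
  · have := hμ α hα
    have := hν α hα
    simp only [Pi.add_apply, Pi.smul_apply, smul_eq_mul]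
    positivity
  · simp only [Pi.add_apply, Pi.smul_apply, smul_eq_mul, Finset.sum_add_distrib,
      ← Finset.mul_sum, hμ0, hν0, mul_zero, add_zero]

theorem smul_mem_coneN {A : Finset (EuclideanSpace ℝ (Fin n))} {β : A} {ν : A → ℝ}
    (hν : ν ∈ coneN A β) {s : ℝ} (hs : 0 ≤ s) : s • ν ∈ coneN A β :=
  ⟨fun α hα => mul_nonneg hs (hν.1 α hα), by
    simp only [Pi.smul_apply, smul_eq_mul, ← Finset.mul_sum, hν.2, mul_zero]⟩

theorem isClosed_coneN (A : Finset (EuclideanSpace ℝ (Fin n))) (β : A) :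
    IsClosed (coneN A β) := by
  have : coneN A β = (⋂ α, ⋂ _ : α ≠ β, {ν | 0 ≤ ν α}) ∩ {ν | ∑ α, ν α = 0} := by
    ext; simp [coneN]
  rw [this]
  exact (isClosed_iInter fun α => isClosed_iInter fun _ =>
    isClosed_le continuous_const (by fun_prop)).inter (isClosed_eq (by fun_prop) (by fun_prop))

theorem sum_erase_of_mem_coneN {A : Finset (EuclideanSpace ℝ (Fin n))} {β : A} {ν : A → ℝ}
    (hν : ν ∈ coneN A β) : ∑ α ∈ Finset.univ.erase β, ν α = -ν β := by
  have := Finset.add_sum_erase Finset.univ ν (Finset.mem_univ β)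
  rw [hν.2] at this
  linarith

theorem le_neg_of_mem_coneN {A : Finset (EuclideanSpace ℝ (Fin n))} {β : A} {ν : A → ℝ}
    (hν : ν ∈ coneN A β) {α : A} (hα : α ≠ β) : ν α ≤ -ν β := by
  rw [← sum_erase_of_mem_coneN hν]
  exact Finset.single_le_sum (f := ν) (fun γ hγ => hν.1 γ (Finset.ne_of_mem_erase hγ))
    (Finset.mem_erase.2 ⟨hα, Finset.mem_univ α⟩)

theorem apply_self_nonpos_of_mem_coneN {A : Finset (EuclideanSpace ℝ (Fin n))} {β : A}
    {ν : A → ℝ} (hν : ν ∈ coneN A β) : ν β ≤ 0 := by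
  have := Finset.sum_nonneg fun γ (hγ : γ ∈ Finset.univ.erase β) =>
    hν.1 γ (Finset.ne_of_mem_erase hγ)
  rw [sum_erase_of_mem_coneN hν] at this
  linarith

theorem apply_self_neg_of_mem_coneN {A : Finset (EuclideanSpace ℝ (Fin n))} {β : A}
    {ν : A → ℝ} (hν : ν ∈ coneN A β) (h0 : ν ≠ 0) : ν β < 0 := by
  refine lt_of_le_of_ne (apply_self_nonpos_of_mem_coneN hν) fun h => h0 ?_
  ext α
  by_cases hα : α = β
  · rw [hα, h]; rfl
  · have := le_neg_of_mem_coneN hν hα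
    have := hν.1 α hα
    simp only [Pi.zero_apply]
    linarith

/-- `N_β` is pointed, so bounding `-ν_β` bounds all coordinates of `ν`. -/
theorem norm_le_of_mem_coneN {A : Finset (EuclideanSpace ℝ (Fin n))} {β : A} {ν : A → ℝ}
    (hν : ν ∈ coneN A β) : ‖ν‖ ≤ -ν β := by
  have h0 := apply_self_nonpos_of_mem_coneN hν
  rw [pi_norm_le_iff_of_nonneg (by linarith)]
  intro α
  rw [Real.norm_eq_abs, abs_le]
  by_cases hα : α = β
  · subst hα; constructor <;> linarith
  · have := le_neg_of_mem_coneN hν hα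
    have := hν.1 α hα
    constructor <;> linarith

theorem inner_opA_eq_sum_erase {A : Finset (EuclideanSpace ℝ (Fin n))} {β : A} {ν : A → ℝ}
    (hν : ν ∈ coneN A β) (x : EuclideanSpace ℝ (Fin n)) :
    inner ℝ (opA A ν) x = ∑ α ∈ Finset.univ.erase β,
      ν α * inner ℝ ((α : EuclideanSpace ℝ (Fin n)) - β) x := by
  simp only [inner_sub_left, mul_sub, Finset.sum_sub_distrib]
  rw [← Finset.sum_mul, sum_erase_of_mem_coneN hν, inner_opA,
    ← Finset.add_sum_erase Finset.univ _ (Finset.mem_univ β)]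
  ring

/-! ### Signomials -/

theorem signomial_eq_exp_mul {A : Finset (EuclideanSpace ℝ (Fin n))} (β : A) (c : A → ℝ)
    (x : EuclideanSpace ℝ (Fin n)) :
    signomial A c x = Real.exp (inner ℝ (β : EuclideanSpace ℝ (Fin n)) x) *
      (c β + ∑ α ∈ Finset.univ.erase β,
        c α * Real.exp (inner ℝ ((α : EuclideanSpace ℝ (Fin n)) - β) x)) := by
  rw [signomial, ← Finset.add_sum_erase Finset.univ _ (Finset.mem_univ β), mul_add,
    Finset.mul_sum]
  congr 1
  · ring
  · refine Finset.sum_congr rfl fun α _ => ?_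
    rw [inner_sub_left, mul_left_comm, ← Real.exp_add]
    ring_nf

theorem signomial_smul_add (A : Finset (EuclideanSpace ℝ (Fin n))) (s t : ℝ) (c d : A → ℝ) :
    signomial A (s • c + t • d) = s • signomial A c + t • signomial A d := by
  ext x
  simp only [signomial, Pi.add_apply, Pi.smul_apply, smul_eq_mul, Finset.mul_sum, add_mul,
    Finset.sum_add_distrib, mul_assoc]

theorem signomial_sum_smul (A : Finset (EuclideanSpace ℝ (Fin n))) {ι : Type*} [Fintype ι]
    (w : ι → ℝ) (c : ι → A → ℝ) :
    signomial A (∑ i, w i • c i) = ∑ i, w i • signomial A (c i) := by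
  ext x
  simp only [signomial, Finset.sum_apply, Pi.smul_apply, smul_eq_mul, Finset.mul_sum,
    Finset.sum_mul, mul_assoc]
  exact Finset.sum_comm

theorem convex_ageCone (X : Set (EuclideanSpace ℝ (Fin n)))
    (A : Finset (EuclideanSpace ℝ (Fin n))) (β : A) : Convex ℝ (ageCone X A β) := by
  rintro _ ⟨c, rfl, hc, hc'⟩ _ ⟨d, rfl, hd, hd'⟩ s t hs ht -
  refine ⟨s • c + t • d, (signomial_smul_add A s t c d).symm, fun x hx => ?_, fun α hα => ?_⟩
  · exact add_nonneg (mul_nonneg hs (hc x hx)) (mul_nonneg ht (hd x hx))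
  · exact add_nonneg (mul_nonneg hs (hc' α hα)) (mul_nonneg ht (hd' α hα))

theorem posynomials_subset_ageCone (X : Set (EuclideanSpace ℝ (Fin n)))
    (A : Finset (EuclideanSpace ℝ (Fin n))) (β : A) : posynomials A ⊆ ageCone X A β := by
  rintro _ ⟨c, rfl, hc⟩
  exact ⟨c, rfl, fun x _ => Finset.sum_nonneg fun α _ => mul_nonneg (hc α) (Real.exp_pos _).le,
    fun α _ => hc α⟩

/-! ### Witnessed cones are contained in the AGE cone -/

theorem witness_ineq_iff {X : Set (EuclideanSpace ℝ (Fin n))}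
    {A : Finset (EuclideanSpace ℝ (Fin n))} {lam : A → ℝ} {s : ℝ} (hs : augSupport X A lam = s)
    (b p : ℝ) :
    (b : EReal) * (EReal.exp (augSupport X A lam) : EReal) ≤ (p : EReal) ↔
      b * Real.exp s ≤ p := by
  rw [hs, EReal.exp_coe, EReal.coe_ennreal_ofReal, max_eq_left (Real.exp_pos s).le,
    ← EReal.coe_mul, EReal.coe_le_coe_iff]

theorem filter_pos_subset_erase {A : Finset (EuclideanSpace ℝ (Fin n))} {β : A} {lam : A → ℝ}
    (h : lam β ≤ 0) :
    (Finset.univ.filter fun α => 0 < lam α) ⊆ Finset.univ.erase β := by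
  intro α hα
  rw [Finset.mem_filter] at hα
  refine Finset.mem_erase.2 ⟨?_, Finset.mem_univ α⟩
  rintro rfl
  linarith [hα.2]

theorem sum_filter_pos {A : Finset (EuclideanSpace ℝ (Fin n))} {β : A} {lam : A → ℝ}
    (h : lam ∈ coneN A β) (g : A → ℝ) :
    ∑ α with 0 < lam α, lam α * g α = ∑ α ∈ Finset.univ.erase β, lam α * g α := by
  refine Finset.sum_subset (filter_pos_subset_erase (apply_self_nonpos_of_mem_coneN h))
    fun α hα hα' => ?_
  have h0 := h.1 α (Finset.ne_of_mem_erase hα)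
  have : lam α = 0 := by
    rw [Finset.mem_filter] at hα'
    push Not at hα'
    exact le_antisymm (hα' (Finset.mem_univ α)) h0
  rw [this, zero_mul]

/-- This is the weighted AM–GM inequality with weights `lam`. -/
theorem witnessedAGECone_subset_ageCone {X : Set (EuclideanSpace ℝ (Fin n))} (hX : X.Nonempty)
    {A : Finset (EuclideanSpace ℝ (Fin n))} {β : A} {lam : A → ℝ}
    (hlam : lam ∈ normalizedXCircuits X A β) : witnessedAGECone X A β lam ⊆ ageCone X A β := by
  obtain ⟨⟨hN, -, htop, -⟩, hβ⟩ := hlam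
  obtain ⟨s, hs⟩ := exists_augSupport_eq_coe hX htop
  rintro _ ⟨c, rfl, hc, hc0⟩
  refine ⟨c, rfl, fun x hx => ?_, hc0⟩
  rw [witness_ineq_iff hs] at hc
  have hsx := augSupport_le_coe_iff.1 hs.le x hx
  rw [signomial_eq_exp_mul β]
  refine mul_nonneg (Real.exp_pos _).le ?_
  have hsub := filter_pos_subset_erase (β := β) (lam := lam) (by linarith)
  have hpos : ∀ α ∈ Finset.univ.filter (fun α => 0 < lam α), 0 < lam α := fun α hα =>
    (Finset.mem_filter.1 hα).2
  have hcpos : ∀ α ∈ Finset.univ.filter (fun α => 0 < lam α), 0 ≤ c α := fun α hα =>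
    hc0 α (Finset.ne_of_mem_erase (hsub hα))
  set E : A → ℝ := fun α => Real.exp (inner ℝ ((α : EuclideanSpace ℝ (Fin n)) - β) x) with hE
  have hsum1 : ∑ α with 0 < lam α, lam α = 1 := by
    have := sum_filter_pos hN fun _ => 1
    simp only [mul_one, sum_erase_of_mem_coneN hN, hβ, neg_neg] at this
    exact this
  have amgm := Real.geom_mean_le_arith_mean_weighted (Finset.univ.filter fun α => 0 < lam α)
    lam (fun α => c α / lam α * E α) (fun α hα => (hpos α hα).le) hsum1
    (fun α hα => mul_nonneg (div_nonneg (hcpos α hα) (hpos α hα).le) (Real.exp_pos _).le)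
  have hprod : ∏ α with 0 < lam α, (c α / lam α * E α) ^ lam α =
      (∏ α with 0 < lam α, (c α / lam α) ^ lam α) * Real.exp (inner ℝ (opA A lam) x) := by
    rw [inner_opA_eq_sum_erase hN, ← sum_filter_pos hN, Real.exp_sum, ← Finset.prod_mul_distrib]
    refine Finset.prod_congr rfl fun α hα => ?_
    rw [Real.mul_rpow (div_nonneg (hcpos α hα) (hpos α hα).le) (Real.exp_pos _).le,
      ← Real.exp_mul, mul_comm (lam α)]
  have hsumle : ∑ α with 0 < lam α, lam α * (c α / lam α * E α) ≤
      ∑ α ∈ Finset.univ.erase β, c α * E α := by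
    refine (Finset.sum_congr rfl fun α hα => ?_).trans_le (Finset.sum_le_sum_of_subset_of_nonneg
      hsub fun α hα _ => mul_nonneg (hc0 α (Finset.ne_of_mem_erase hα)) (Real.exp_pos _).le)
    have := (hpos α hα).ne'
    field_simp
  rw [hprod] at amgm
  by_cases hb : 0 ≤ c β
  · exact add_nonneg hb (Finset.sum_nonneg fun α hα =>
      mul_nonneg (hc0 α (Finset.ne_of_mem_erase hα)) (Real.exp_pos _).le)
  · have h1 : -c β ≤ -c β * Real.exp s * Real.exp (inner ℝ (opA A lam) x) := by
      rw [mul_assoc, ← Real.exp_add]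
      have : 1 ≤ Real.exp (s + inner ℝ (opA A lam) x) := Real.one_le_exp (by linarith)
      nlinarith
    have h2 := mul_le_mul_of_nonneg_right hc (Real.exp_pos (inner ℝ (opA A lam) x)).le
    linarith

/-! ### Entropy duality -/

/-- The entropy-type function whose maximum over the normalized part of `N_β` is the logarithm of
`∑ α ≠ β, c α * exp ((α - β)ᵀ x)`. -/
def dualFun (A : Finset (EuclideanSpace ℝ (Fin n))) (β : A) (c lam : A → ℝ)
    (x : EuclideanSpace ℝ (Fin n)) : ℝ :=
  ∑ α ∈ Finset.univ.erase β, (lam α * Real.log (c α) + Real.negMulLog (lam α)) +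
    inner ℝ (opA A lam) x

/-- The normalized vectors of `N_β` that vanish wherever `c` does. There the value
`Real.log 0 = 0` in `dualFun` is harmless. -/
def dualDomain (A : Finset (EuclideanSpace ℝ (Fin n))) (β : A) (c : A → ℝ) : Set (A → ℝ) :=
  {lam | lam ∈ coneN A β ∧ lam β = -1 ∧ ∀ α, α ≠ β → c α = 0 → lam α = 0}

theorem convex_dualDomain (A : Finset (EuclideanSpace ℝ (Fin n))) (β : A) (c : A → ℝ) :
    Convex ℝ (dualDomain A β c) := by
  rintro μ ⟨hμ, hμ1, hμ0⟩ ν ⟨hν, hν1, hν0⟩ s t hs ht hst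
  refine ⟨convex_coneN A β hμ hν hs ht hst, ?_, fun α hα hc => ?_⟩
  · simp only [Pi.add_apply, Pi.smul_apply, smul_eq_mul, hμ1, hν1]
    linarith
  · simp [hμ0 α hα hc, hν0 α hα hc]

theorem isCompact_dualDomain (A : Finset (EuclideanSpace ℝ (Fin n))) (β : A) (c : A → ℝ) :
    IsCompact (dualDomain A β c) := by
  refine Metric.isCompact_of_isClosed_isBounded ?_ ?_
  · have : dualDomain A β c = coneN A β ∩ ({ν | ν β = -1} ∩
        ⋂ α, ⋂ _ : α ≠ β, ⋂ _ : c α = 0, {ν : A → ℝ | ν α = 0}) := by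
      ext
      simp only [dualDomain, Set.mem_inter_iff, Set.mem_iInter, Set.mem_ofPred_eq]
    rw [this]
    exact (isClosed_coneN A β).inter ((isClosed_eq (by fun_prop) (by fun_prop)).inter
      (isClosed_iInter fun α => isClosed_iInter fun _ => isClosed_iInter fun _ =>
        isClosed_eq (by fun_prop) (by fun_prop)))
  · refine isBounded_iff_forall_norm_le.2 ⟨1, fun ν hν => ?_⟩
    have := norm_le_of_mem_coneN hν.1
    rwa [hν.2.1, neg_neg] at this

theorem continuous_dualFun_left (A : Finset (EuclideanSpace ℝ (Fin n))) (β : A) (c : A → ℝ)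
    (x : EuclideanSpace ℝ (Fin n)) : Continuous fun lam => dualFun A β c lam x := by
  have := continuous_opA A
  unfold dualFun
  fun_prop

theorem concaveOn_dualFun (A : Finset (EuclideanSpace ℝ (Fin n))) (β : A) (c : A → ℝ)
    (x : EuclideanSpace ℝ (Fin n)) :
    ConcaveOn ℝ (dualDomain A β c) fun lam => dualFun A β c lam x := by
  refine ⟨convex_dualDomain A β c, fun μ hμ ν hν s t hs ht hst => ?_⟩
  simp only [dualFun, opA_add, opA_smul, inner_add_left, real_inner_smul_left, smul_eq_mul,
    Pi.add_apply, Pi.smul_apply]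
  have h : ∑ α ∈ Finset.univ.erase β,
        (s * (μ α * Real.log (c α) + Real.negMulLog (μ α)) +
          t * (ν α * Real.log (c α) + Real.negMulLog (ν α))) ≤
      ∑ α ∈ Finset.univ.erase β, ((s * μ α + t * ν α) * Real.log (c α) +
        Real.negMulLog (s * μ α + t * ν α)) := by
    refine Finset.sum_le_sum fun α hα => ?_
    have hα := Finset.ne_of_mem_erase hα
    have := Real.concaveOn_negMulLog.2 (hμ.1.1 α hα) (hν.1.1 α hα) hs ht hst
    simp only [smul_eq_mul] at this
    linarith
  rw [Finset.sum_add_distrib, ← Finset.mul_sum, ← Finset.mul_sum] at h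
  linarith

/-- The maximizer is the vector of normalized terms of the sum (the softmax). -/
theorem exists_dualFun_ge {A : Finset (EuclideanSpace ℝ (Fin n))} {β : A} {c : A → ℝ}
    (hc : ∀ α, α ≠ β → 0 ≤ c α) (hβ : c β < 0) {x : EuclideanSpace ℝ (Fin n)}
    (hx : 0 ≤ signomial A c x) :
    ∃ lam ∈ dualDomain A β c, Real.log (-c β) ≤ dualFun A β c lam x := by
  set E : A → ℝ := fun α => inner ℝ ((α : EuclideanSpace ℝ (Fin n)) - β) x with hE
  set Z : ℝ := ∑ α ∈ Finset.univ.erase β, c α * Real.exp (E α) with hZ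
  have hZge : -c β ≤ Z := by
    rw [signomial_eq_exp_mul β] at hx
    have := nonneg_of_mul_nonneg_right hx (Real.exp_pos _)
    linarith
  have hZpos : 0 < Z := by linarith
  set lam : A → ℝ := fun α => if α = β then -1 else c α * Real.exp (E α) / Z with hlam
  have hlamβ : lam β = -1 := by simp [hlam]
  have hlamα : ∀ α, α ≠ β → lam α = c α * Real.exp (E α) / Z := fun α hα => by simp [hlam, hα]
  have hsum : ∑ α ∈ Finset.univ.erase β, lam α = 1 := by
    rw [Finset.sum_congr rfl fun α hα => hlamα α (Finset.ne_of_mem_erase hα), ← Finset.sum_div,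
      ← hZ, div_self hZpos.ne']
  have hN : lam ∈ coneN A β := by
    refine ⟨fun α hα => ?_, ?_⟩
    · rw [hlamα α hα]
      exact div_nonneg (mul_nonneg (hc α hα) (Real.exp_pos _).le) hZpos.le
    · rw [← Finset.add_sum_erase Finset.univ _ (Finset.mem_univ β), hsum, hlamβ]
      norm_num
  refine ⟨lam, ⟨hN, hlamβ, fun α hα h0 => by simp [hlamα α hα, h0]⟩, ?_⟩
  have hval : dualFun A β c lam x = Real.log Z := by
    rw [dualFun, inner_opA_eq_sum_erase hN, ← Finset.sum_add_distrib]
    have : ∀ α ∈ Finset.univ.erase β, lam α * Real.log (c α) + Real.negMulLog (lam α) +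
        lam α * E α = lam α * Real.log Z := by
      intro α hα
      have hα := Finset.ne_of_mem_erase hα
      rcases (hc α hα).eq_or_lt with h0 | h0
      · have : lam α = 0 := by simp [hlamα α hα, ← h0]
        simp [this]
      · have : Real.log (lam α) = Real.log (c α) + E α - Real.log Z := by
          rw [hlamα α hα, Real.log_div (by positivity) hZpos.ne',
            Real.log_mul h0.ne' (Real.exp_pos _).ne', Real.log_exp]
        rw [Real.negMulLog, this]
        ring
    rw [Finset.sum_congr rfl this, ← Finset.sum_mul, hsum, one_mul]
  rw [hval]
  exact Real.log_le_log (by linarith) hZge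

/-- Nonnegativity on `X` provides a good dual vector for each single point of `X`; the minimax
theorem and compactness of the dual domain yield one that is good for all points of `X`. -/
theorem exists_forall_dualFun_ge {X : Set (EuclideanSpace ℝ (Fin n))} (hXconv : Convex ℝ X)
    (hX : X.Nonempty) {A : Finset (EuclideanSpace ℝ (Fin n))} {β : A} {c : A → ℝ}
    (hc : ∀ α, α ≠ β → 0 ≤ c α) (hβ : c β < 0) (hf : ∀ x ∈ X, 0 ≤ signomial A c x) :
    ∃ lam ∈ dualDomain A β c, ∀ x ∈ X, Real.log (-c β) ≤ dualFun A β c lam x := by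
  have hne : (dualDomain A β c).Nonempty := by
    obtain ⟨x, hx⟩ := hX
    obtain ⟨lam, hlam, -⟩ := exists_dualFun_ge hc hβ (hf x hx)
    exact ⟨lam, hlam⟩
  have key : (dualDomain A β c ∩
      ⋂ x : X, {lam | Real.log (-c β) ≤ dualFun A β c lam x}).Nonempty := by
    refine (isCompact_dualDomain A β c).inter_iInter_nonempty _
      (fun x => isClosed_le continuous_const (continuous_dualFun_left A β c x)) fun u => ?_
    by_contra hempty
    rw [Set.not_nonempty_iff_eq_empty, Set.eq_empty_iff_forall_notMem] at hempty
    obtain ⟨y, hy, hlt⟩ := Sion.exists_lt_iInf_of_lt_iInf_of_finite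
      (X := dualDomain A β c) (Y := X) (f := fun lam x => -dualFun A β c lam x)
      hne (isCompact_dualDomain A β c)
      (fun x _ => (continuous_dualFun_left A β c x).neg.lowerSemicontinuous.lowerSemicontinuousOn _)
      (fun x _ => (concaveOn_dualFun A β c x).neg.quasiconvexOn)
      hXconv
      (fun lam _ => by
        refine (Continuous.upperSemicontinuous ?_).upperSemicontinuousOn _
        unfold dualFun
        fun_prop)
      (fun lam _ => by
        refine ConcaveOn.quasiconcaveOn ⟨hXconv, fun x _ y _ s t _ _ hst => le_of_eq ?_⟩
        obtain rfl : t = 1 - s := by linarith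
        simp only [dualFun, inner_add_right, real_inner_smul_right, smul_eq_mul]
        ring)
      (convex_dualDomain A β c)
      (s := Subtype.val '' (u : Set X)) (u.finite_toSet.image _)
      (Subtype.coe_image_subset X u) (t := -Real.log (-c β))
      (by
        intro lam hlam
        by_contra hcon
        push Not at hcon
        refine hempty lam ⟨hlam, Set.mem_iInter₂.2 fun x hx => ?_⟩
        exact neg_le_neg_iff.1 (hcon x ⟨x, hx, rfl⟩))
    obtain ⟨lam, hlam, hge⟩ := exists_dualFun_ge hc hβ (hf y hy)
    linarith [hlt lam hlam]
  obtain ⟨lam, hlam, hge⟩ := key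
  exact ⟨lam, hlam, fun x hx => Set.mem_iInter.1 hge ⟨x, hx⟩⟩

/-! ### Decomposition into circuits -/

/-- The unit sublevel set of the sublinear function `ν ↦ σ_X(-A ν) + (A ν)ᵀ x₀ - ν_β` on `N_β`.
For `x₀ ∈ X` this function is positive away from the origin, so the sublevel set is compact even
where `σ_X` is unbounded. -/
def gaugeBall (X : Set (EuclideanSpace ℝ (Fin n))) (A : Finset (EuclideanSpace ℝ (Fin n)))
    (β : A) (x₀ : EuclideanSpace ℝ (Fin n)) : Set (A → ℝ) :=
  {ν | ν ∈ coneN A β ∧ ∀ x ∈ X, -ν β + inner ℝ (opA A ν) (x₀ - x) ≤ 1}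

theorem isCompact_gaugeBall {X : Set (EuclideanSpace ℝ (Fin n))}
    (A : Finset (EuclideanSpace ℝ (Fin n))) (β : A) {x₀ : EuclideanSpace ℝ (Fin n)}
    (hx₀ : x₀ ∈ X) : IsCompact (gaugeBall X A β x₀) := by
  refine Metric.isCompact_of_isClosed_isBounded ?_ ?_
  · have : gaugeBall X A β x₀ = coneN A β ∩
        ⋂ x, ⋂ _ : x ∈ X, {ν | -ν β + inner ℝ (opA A ν) (x₀ - x) ≤ 1} := by
      ext; simp [gaugeBall]
    rw [this]
    have := continuous_opA A
    exact (isClosed_coneN A β).inter (isClosed_iInter fun x => isClosed_iInter fun _ =>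
      isClosed_le (by fun_prop) continuous_const)
  · refine isBounded_iff_forall_norm_le.2 ⟨1, fun ν hν => (norm_le_of_mem_coneN hν.1).trans ?_⟩
    simpa using hν.2 x₀ hx₀

/-- A normalized extreme point of `gaugeBall` is a circuit: two vectors that violate the circuit
property can be rescaled to the same gauge as the given one, which contradicts extremality. -/
theorem smul_mem_normalizedXCircuits {X : Set (EuclideanSpace ℝ (Fin n))}
    {A : Finset (EuclideanSpace ℝ (Fin n))} {β : A} {x₀ : EuclideanSpace ℝ (Fin n)}
    (hx₀ : x₀ ∈ X) {ν : A → ℝ} (hν : ν ∈ (gaugeBall X A β x₀).extremePoints ℝ) (h0 : ν ≠ 0) :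
    (-ν β)⁻¹ • ν ∈ normalizedXCircuits X A β := by
  obtain ⟨⟨hN, hν1⟩, hext⟩ := hν
  have hneg := apply_self_neg_of_mem_coneN hN h0
  set a : ℝ := -ν β with ha
  have hapos : 0 < a := by linarith
  have hbound : augSupport X A (a⁻¹ • ν) ≤
      ((a⁻¹ * (1 + ν β - inner ℝ (opA A ν) x₀) : ℝ) : EReal) := by
    refine augSupport_le_coe_iff.2 fun x hx => ?_
    have := hν1 x hx
    rw [inner_sub_right] at this
    rw [opA_smul, real_inner_smul_left, ← mul_neg]
    exact mul_le_mul_of_nonneg_left (by linarith) (inv_pos.2 hapos).le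
  refine ⟨⟨smul_mem_coneN hN (inv_pos.2 hapos).le, smul_ne_zero (inv_pos.2 hapos).ne' h0,
    hbound.trans_lt (EReal.coe_lt_top _), ?_⟩, ?_⟩
  · rintro ⟨ν₁, hν₁, ν₂, hν₂, s, t, hs, ht, hst, heq, hind, hfin₁, hfin₂, hlin⟩
    have hne₁ : ν₁ ≠ 0 := by simpa using hind.ne_zero 0
    have hne₂ : ν₂ ≠ 0 := by simpa using hind.ne_zero 1
    obtain ⟨σ₁, hσ₁⟩ := exists_augSupport_eq_coe ⟨x₀, hx₀⟩ hfin₁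
    obtain ⟨σ₂, hσ₂⟩ := exists_augSupport_eq_coe ⟨x₀, hx₀⟩ hfin₂
    have hσ := hlin s t hs.le ht.le hst
    rw [← heq, hσ₁, hσ₂, ← EReal.coe_mul, ← EReal.coe_mul, ← EReal.coe_add] at hσ
    -- the values of the gauge at `ν₁` and `ν₂`
    set γ₁ : ℝ := -ν₁ β + σ₁ + inner ℝ (opA A ν₁) x₀ with hγ₁
    set γ₂ : ℝ := -ν₂ β + σ₂ + inner ℝ (opA A ν₂) x₀ with hγ₂
    have hγ₁pos : 0 < γ₁ := by
      have := augSupport_le_coe_iff.1 hσ₁.le x₀ hx₀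
      have := apply_self_neg_of_mem_coneN hν₁ hne₁
      linarith
    have hγ₂pos : 0 < γ₂ := by
      have := augSupport_le_coe_iff.1 hσ₂.le x₀ hx₀
      have := apply_self_neg_of_mem_coneN hν₂ hne₂
      linarith
    set h : ℝ := s * γ₁ + t * γ₂ with hh
    have hhpos : 0 < h := by positivity
    have heq' : ν = a • (s • ν₁ + t • ν₂) := by
      rw [← heq, smul_smul, mul_inv_cancel₀ hapos.ne', one_smul]
    have hνβ : -ν β = a * (s * -ν₁ β + t * -ν₂ β) := by
      rw [heq']; simp only [Pi.add_apply, Pi.smul_apply, smul_eq_mul]; ring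
    have hνx : ∀ x, inner ℝ (opA A ν) x =
        a * (s * inner ℝ (opA A ν₁) x + t * inner ℝ (opA A ν₂) x) := by
      intro x
      rw [heq', opA_smul, opA_add, opA_smul, opA_smul]
      simp only [inner_add_left, real_inner_smul_left]
    have hle : a * h ≤ 1 := by
      rw [hσ, EReal.coe_le_coe_iff, inv_mul_eq_div, le_div_iff₀ hapos, hνx x₀] at hbound
      have : a * h = (s * σ₁ + t * σ₂) * a + a * (s * -ν₁ β + t * -ν₂ β) +
          a * (s * inner ℝ (opA A ν₁) x₀ + t * inner ℝ (opA A ν₂) x₀) := by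
        rw [hh, hγ₁, hγ₂]; ring
      rw [this, ← hνβ]
      linarith
    have hmem : ∀ (μ : A → ℝ) (σ γ : ℝ), μ ∈ coneN A β → augSupport X A μ = σ →
        γ = -μ β + σ + inner ℝ (opA A μ) x₀ → 0 < γ →
        (a * h / γ) • μ ∈ gaugeBall X A β x₀ := by
      intro μ σ γ hμ hσμ hγ hγpos
      have hr : 0 ≤ a * h / γ := by positivity
      refine ⟨smul_mem_coneN hμ hr, fun x hx => ?_⟩
      have := augSupport_le_coe_iff.1 hσμ.le x hx
      rw [opA_smul, real_inner_smul_left, inner_sub_right, Pi.smul_apply, smul_eq_mul]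
      calc -(a * h / γ * μ β) + a * h / γ * (inner ℝ (opA A μ) x₀ - inner ℝ (opA A μ) x)
          = a * h / γ * (-μ β + (inner ℝ (opA A μ) x₀ - inner ℝ (opA A μ) x)) := by ring
        _ ≤ a * h / γ * γ := mul_le_mul_of_nonneg_left (by linarith) hr
        _ = a * h := div_mul_cancel₀ _ hγpos.ne'
        _ ≤ 1 := hle
    have hcomb : (s * γ₁ / h) • ((a * h / γ₁) • ν₁) + (t * γ₂ / h) • ((a * h / γ₂) • ν₂) = ν := by
      rw [heq', smul_add, smul_smul, smul_smul, smul_smul, smul_smul]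
      congr 2 <;> field_simp
    have hseg : ν ∈ openSegment ℝ ((a * h / γ₁) • ν₁) ((a * h / γ₂) • ν₂) :=
      ⟨s * γ₁ / h, t * γ₂ / h, by positivity, by positivity, by
        rw [← add_div, ← hh, div_self hhpos.ne'], hcomb⟩
    have h1 := hext (hmem ν₁ σ₁ γ₁ hν₁ hσ₁ hγ₁ hγ₁pos) (hmem ν₂ σ₂ γ₂ hν₂ hσ₂ hγ₂ hγ₂pos) hseg
    have h2 := hext (hmem ν₂ σ₂ γ₂ hν₂ hσ₂ hγ₂ hγ₂pos) (hmem ν₁ σ₁ γ₁ hν₁ hσ₁ hγ₁ hγ₁pos)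
      (by rwa [openSegment_symm])
    have hdep : (a * h / γ₁) • ν₁ + (-(a * h / γ₂)) • ν₂ = 0 := by
      rw [h1, neg_smul, h2, add_neg_cancel]
    have := (LinearIndependent.pair_iff.1 hind _ _ hdep).1
    have hpos : 0 < a * h / γ₁ := by positivity
    exact hpos.ne' this
  · rw [Pi.smul_apply, smul_eq_mul, inv_mul_eq_div, div_eq_iff hapos.ne', ha]
    ring

/-- A normalized `ν` with finite augmented support function is a convex combination of normalized
circuits along which this function does not increase. -/
theorem exists_circuit_decomposition {X : Set (EuclideanSpace ℝ (Fin n))} (hX : X.Nonempty)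
    {A : Finset (EuclideanSpace ℝ (Fin n))} {β : A} {ν : A → ℝ} (hν : ν ∈ coneN A β)
    (hνβ : ν β = -1) {s : ℝ} (hs : augSupport X A ν ≤ s) :
    ∃ (ι : Type) (_ : Fintype ι) (θ : ι → ℝ) (lam : ι → A → ℝ) (σ : ι → ℝ),
      (∀ i, lam i ∈ normalizedXCircuits X A β) ∧ (∀ i, augSupport X A (lam i) ≤ σ i) ∧
      (∀ i, 0 < θ i) ∧ ∑ i, θ i = 1 ∧ ∑ i, θ i • lam i = ν ∧ ∑ i, θ i * σ i ≤ s := by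
  classical
  obtain ⟨x₀, hx₀⟩ := hX
  rw [augSupport_le_coe_iff] at hs
  set γ : ℝ := 1 + s + inner ℝ (opA A ν) x₀ with hγ
  have hγpos : 0 < γ := by have := hs x₀ hx₀; linarith
  have hmem : γ⁻¹ • ν ∈ gaugeBall X A β x₀ := by
    refine ⟨smul_mem_coneN hν (inv_pos.2 hγpos).le, fun x hx => ?_⟩
    have := hs x hx
    rw [opA_smul, real_inner_smul_left, inner_sub_right, Pi.smul_apply, smul_eq_mul, hνβ]
    calc -(γ⁻¹ * -1) + γ⁻¹ * (inner ℝ (opA A ν) x₀ - inner ℝ (opA A ν) x)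
        = γ⁻¹ * (1 + (inner ℝ (opA A ν) x₀ - inner ℝ (opA A ν) x)) := by ring
      _ ≤ γ⁻¹ * γ := mul_le_mul_of_nonneg_left (by linarith) (inv_pos.2 hγpos).le
      _ = 1 := inv_mul_cancel₀ hγpos.ne'
  have hconv := (isCompact_gaugeBall A β hx₀).subset_convexHull_extremePoints hmem
  obtain ⟨ι', _, z, w, hz, -, hw, hw1, hsum⟩ := eq_pos_convex_span_of_mem_convexHull hconv
  -- the origin may be one of the extreme points used; it does not contribute to `ν`
  let ι := {i : ι' // z i ≠ 0}
  have hzext : ∀ i, z i ∈ (gaugeBall X A β x₀).extremePoints ℝ := fun i => hz ⟨i, rfl⟩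
  have hzneg : ∀ i : ι, 0 < -z i β := fun i => by
    have := apply_self_neg_of_mem_coneN (hzext i).1.1 i.2
    linarith
  have hνsum : ∑ i : ι, (γ * w i) • z i = ν := by
    have h1 : ∑ i : ι, (γ * w i) • z i = ∑ i : ι', (γ * w i) • z i := by
      rw [← Finset.sum_subtype (Finset.univ.filter fun i => z i ≠ 0) (by simp)
        fun i => (γ * w i) • z i]
      refine Finset.sum_filter_of_ne fun i _ hi h0 => hi ?_
      rw [h0, smul_zero]
    rw [h1]
    simp only [mul_smul, ← Finset.smul_sum]
    rw [hsum, smul_smul, mul_inv_cancel₀ hγpos.ne', one_smul]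
  have hwsum : ∑ i : ι, w i ≤ 1 := by
    rw [← hw1, ← Finset.sum_subtype (Finset.univ.filter fun i => z i ≠ 0) (by simp) w]
    exact Finset.sum_le_sum_of_subset_of_nonneg (Finset.filter_subset _ _) fun i _ _ => (hw i).le
  have hβsum : ∑ i : ι, γ * w i * -z i β = 1 := by
    have := congrFun hνsum β
    rw [hνβ, Finset.sum_apply] at this
    simp only [Pi.smul_apply, smul_eq_mul] at this
    simp only [mul_neg, Finset.sum_neg_distrib, this, neg_neg]
  refine ⟨ι, inferInstance, fun i => γ * w i * -z i β, fun i => (-z i β)⁻¹ • z i,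
    fun i => (-z i β)⁻¹ * (1 + z i β - inner ℝ (opA A (z i)) x₀),
    fun i => smul_mem_normalizedXCircuits hx₀ (hzext i) i.2, fun i => ?_,
    fun i => mul_pos (mul_pos hγpos (hw i)) (hzneg i), hβsum, ?_, ?_⟩
  · refine augSupport_le_coe_iff.2 fun x hx => ?_
    have := (hzext i).1.2 x hx
    rw [inner_sub_right] at this
    rw [opA_smul, real_inner_smul_left, ← mul_neg]
    exact mul_le_mul_of_nonneg_left (by linarith) (inv_pos.2 (hzneg i)).le
  · rw [← hνsum]
    refine Finset.sum_congr rfl fun i _ => ?_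
    rw [smul_smul, mul_assoc, mul_inv_cancel₀ (hzneg i).ne', mul_one]
  · have hinner : ∑ i : ι, γ * w i * inner ℝ (opA A (z i)) x₀ = inner ℝ (opA A ν) x₀ := by
      rw [← hνsum, opA_sum, sum_inner]
      simp only [opA_smul, real_inner_smul_left]
    calc ∑ i : ι, γ * w i * -z i β * ((-z i β)⁻¹ * (1 + z i β - inner ℝ (opA A (z i)) x₀))
        = ∑ i : ι, (γ * w i - γ * w i * -z i β - γ * w i * inner ℝ (opA A (z i)) x₀) := by
          refine Finset.sum_congr rfl fun i _ => ?_
          rw [mul_assoc (γ * w i), mul_inv_cancel_left₀ (hzneg i).ne']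
          ring
      _ = γ * ∑ i : ι, w i - 1 - inner ℝ (opA A ν) x₀ := by
          rw [Finset.sum_sub_distrib, Finset.sum_sub_distrib, hβsum, hinner, Finset.mul_sum]
      _ ≤ s := by
          have := mul_le_mul_of_nonneg_left hwsum hγpos.le
          linarith

/-! ### Decomposition of AGE signomials -/

theorem signomial_mem_convexHull_witnessedAGECone {X : Set (EuclideanSpace ℝ (Fin n))}
    (hXconv : Convex ℝ X) (hX : X.Nonempty) {A : Finset (EuclideanSpace ℝ (Fin n))} {β : A}
    {c : A → ℝ} (hc : ∀ α, α ≠ β → 0 ≤ c α) (hβ : c β < 0)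
    (hf : ∀ x ∈ X, 0 ≤ signomial A c x) :
    signomial A c ∈ convexHull ℝ (⋃ lam ∈ normalizedXCircuits X A β,
      witnessedAGECone X A β lam) := by
  obtain ⟨ν, ⟨hN, hνβ, hν0⟩, hge⟩ := exists_forall_dualFun_ge hXconv hX hc hβ hf
  set H : ℝ := ∑ α ∈ Finset.univ.erase β, (ν α * Real.log (c α) + Real.negMulLog (ν α)) with hH
  have hs : augSupport X A ν ≤ ((H - Real.log (-c β) : ℝ) : EReal) := by
    refine augSupport_le_coe_iff.2 fun x hx => ?_
    have := hge x hx
    rw [dualFun, ← hH] at this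
    linarith
  obtain ⟨ι, _, θ, lam, σ, hlam, hσ, hθ, hθ1, hsum, hle⟩ :=
    exists_circuit_decomposition hX hN hνβ hs
  have hνsum : ∀ α, ∑ i, θ i * lam i α = ν α := fun α => by
    rw [← hsum]
    simp only [Finset.sum_apply, Pi.smul_apply, smul_eq_mul]
  have hνpos : ∀ i α, 0 < lam i α → 0 < ν α := by
    intro i α hi
    have hαβ : α ≠ β := by
      rintro rfl
      linarith [(hlam i).2]
    rw [← hνsum α]
    exact Finset.sum_pos' (fun j _ => mul_nonneg (hθ j).le ((hlam j).1.1.1 α hαβ))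
      ⟨i, Finset.mem_univ i, mul_pos (hθ i) hi⟩
  -- the circuit `lam i` witnesses the coefficient `-exp (L i)` at `β` if it is given
  -- `c α * lam i α / ν α` at the other exponents
  set L : ι → ℝ := fun i => ∑ α ∈ Finset.univ.erase β,
    lam i α * (Real.log (c α) - Real.log (ν α)) - σ i with hL
  have hLsum : Real.log (-c β) ≤ ∑ i, θ i * L i := by
    have h1 : ∑ i, θ i * L i = H - ∑ i, θ i * σ i := by
      simp only [hL, mul_sub, Finset.sum_sub_distrib, Finset.mul_sum]
      rw [Finset.sum_comm, Finset.sum_comm (f := fun i α => θ i * (lam i α * Real.log (ν α)))]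
      simp only [← mul_assoc, ← Finset.sum_mul, hνsum]
      rw [hH, Finset.sum_add_distrib]
      simp only [Real.negMulLog, neg_mul, Finset.sum_neg_distrib]
      ring
    linarith
  set M : ℝ := ∑ i, θ i * Real.exp (L i) with hM
  have hMge : 0 ≤ M + c β := by
    have h1 := convexOn_exp.map_sum_le (t := Finset.univ) (w := θ) (p := L)
      (fun i _ => (hθ i).le) hθ1 fun i _ => Set.mem_univ _
    simp only [smul_eq_mul] at h1
    have h2 := Real.exp_le_exp.2 hLsum
    rw [Real.exp_log (by linarith)] at h2
    linarith
  let d : ι → A → ℝ := fun i α =>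
    if α = β then -Real.exp (L i) + (M + c β) else
      if ν α = 0 then c α else c α * lam i α / ν α
  have hdsum : ∑ i, θ i • d i = c := by
    ext α
    simp only [Finset.sum_apply, Pi.smul_apply, smul_eq_mul]
    by_cases hα : α = β
    · subst hα
      simp only [d, if_true, mul_add, Finset.sum_add_distrib, ← Finset.sum_mul, hθ1, mul_neg,
        Finset.sum_neg_distrib, ← hM]
      ring
    · by_cases h0 : ν α = 0
      · simp only [d, if_neg hα, if_pos h0, ← Finset.sum_mul, hθ1, one_mul]
      · simp only [d, if_neg hα, if_neg h0]
        calc ∑ i, θ i * (c α * lam i α / ν α) = (∑ i, θ i * lam i α) * (c α / ν α) := by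
              rw [Finset.sum_mul]
              exact Finset.sum_congr rfl fun i _ => by ring
          _ = c α := by rw [hνsum, mul_div_cancel₀ _ h0]
  rw [← hdsum, signomial_sum_smul]
  refine (convex_convexHull ℝ _).sum_mem (fun i _ => (hθ i).le) hθ1 fun i _ =>
    subset_convexHull ℝ _ (Set.mem_biUnion (hlam i) ⟨d i, rfl, ?_, fun α hα => ?_⟩)
  · obtain ⟨s, hs⟩ := exists_augSupport_eq_coe hX (hlam i).1.2.2.1
    rw [witness_ineq_iff hs]
    have hsσ : s ≤ σ i := EReal.coe_le_coe_iff.1 (hs ▸ hσ i)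
    have hprod : ∏ α with 0 < lam i α, (d i α / lam i α) ^ lam i α = Real.exp (L i + σ i) := by
      rw [hL, sub_add_cancel, ← sum_filter_pos (hlam i).1.1, Real.exp_sum]
      refine Finset.prod_congr rfl fun α hα => ?_
      have hα := (Finset.mem_filter.1 hα).2
      have hαβ : α ≠ β := by
        rintro rfl
        linarith [(hlam i).2]
      have hνα := hνpos i α hα
      have hcα : 0 < c α :=
        lt_of_le_of_ne (hc α hαβ) fun h => hνα.ne' (hν0 α hαβ h.symm)
      have : d i α / lam i α = c α / ν α := by
        simp only [d, if_neg hαβ, if_neg hνα.ne']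
        field_simp
      rw [this, Real.rpow_def_of_pos (by positivity), Real.log_div hcα.ne' hνα.ne', mul_comm]
    rw [hprod]
    calc -d i β * Real.exp s ≤ Real.exp (L i) * Real.exp s := by
          refine mul_le_mul_of_nonneg_right ?_ (Real.exp_pos s).le
          simp only [d, if_true]
          linarith
      _ ≤ Real.exp (L i + σ i) := by
          rw [← Real.exp_add]
          exact Real.exp_le_exp.2 (by linarith)
  · simp only [d, if_neg hα]
    split_ifs with h0
    · exact hc α hα
    · exact div_nonneg (mul_nonneg (hc α hα) ((hlam i).1.1.1 α hα)) (hN.1 α hα)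

theorem posynomials_subset_witnessedAGECone {X : Set (EuclideanSpace ℝ (Fin n))}
    (hX : X.Nonempty) {A : Finset (EuclideanSpace ℝ (Fin n))} {β : A} {lam : A → ℝ}
    (hlam : lam ∈ normalizedXCircuits X A β) : posynomials A ⊆ witnessedAGECone X A β lam := by
  rintro _ ⟨c, rfl, hc⟩
  obtain ⟨s, hs⟩ := exists_augSupport_eq_coe hX hlam.1.2.2.1
  refine ⟨c, rfl, (witness_ineq_iff hs _ _).2 ?_, fun α _ => hc α⟩
  calc -c β * Real.exp s ≤ 0 :=
        mul_nonpos_of_nonpos_of_nonneg (neg_nonpos.2 (hc β)) (Real.exp_pos s).le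
    _ ≤ ∏ α with 0 < lam α, (c α / lam α) ^ lam α :=
        Finset.prod_nonneg fun α hα =>
          Real.rpow_nonneg (div_nonneg (hc α) (Finset.mem_filter.1 hα).2.le) _

/-- An AGE signomial is a posynomial unless its coefficient at `β` is negative. -/
theorem ageCone_subset_posynomials_union {X : Set (EuclideanSpace ℝ (Fin n))}
    (hXconv : Convex ℝ X) (hX : X.Nonempty) (A : Finset (EuclideanSpace ℝ (Fin n))) (β : A) :
    ageCone X A β ⊆ posynomials A ∪ convexHull ℝ (⋃ lam ∈ normalizedXCircuits X A β,
      witnessedAGECone X A β lam) := by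
  rintro _ ⟨c, rfl, hf, hc⟩
  rcases lt_or_ge (c β) 0 with hβ | hβ
  · exact Or.inr (signomial_mem_convexHull_witnessedAGECone hXconv hX hc hβ hf)
  · refine Or.inl ⟨c, rfl, fun α => ?_⟩
    by_cases hα : α = β
    · rwa [hα]
    · exact hc α hα

end CondSAGE

end

theorem theorem4p4 (n : ℕ) (X : Set (EuclideanSpace ℝ (Fin n)))
    (hXclosed : IsClosed X) (hXconvex : Convex ℝ X) (hXne : X.Nonempty)
    (A : Finset (EuclideanSpace ℝ (Fin n)))
    (hlin : LinearIndependent ℝ (fun (α : A) (x : X) =>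
      Real.exp (inner ℝ (α : EuclideanSpace ℝ (Fin n)) (x : EuclideanSpace ℝ (Fin n)))))
    (β : A) :
    ((CondSAGE.normalizedXCircuits X A β).Nonempty →
      CondSAGE.ageCone X A β =
        convexHull ℝ (⋃ lam ∈ CondSAGE.normalizedXCircuits X A β,
          CondSAGE.witnessedAGECone X A β lam)) ∧
    (CondSAGE.normalizedXCircuits X A β = ∅ →
      CondSAGE.ageCone X A β = CondSAGE.posynomials A) := by
  have hsub := CondSAGE.ageCone_subset_posynomials_union hXconvex hXne A β
  refine ⟨fun ⟨lam, hlam⟩ => ?_, fun hempty => ?_⟩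
  · refine (hsub.trans (Set.union_subset ?_ subset_rfl)).antisymm ?_
    · exact (CondSAGE.posynomials_subset_witnessedAGECone hXne hlam).trans
        ((Set.subset_biUnion_of_mem hlam).trans (subset_convexHull ℝ _))
    · exact convexHull_min (Set.iUnion₂_subset fun μ hμ =>
        CondSAGE.witnessedAGECone_subset_ageCone hXne hμ) (CondSAGE.convex_ageCone X A β)
  · refine (hsub.trans ?_).antisymm (CondSAGE.posynomials_subset_ageCone X A β)
    simp [hempty]
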